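/- Let $d\ge 1$, let $H\le \mathrm{GL}(d,\mathbb{R})$ be a closed subgroup with left Haar measure $dh$ and modular function $\Delta_H$ (normalized by $\mu_H(Eh)=\Delta_H(h)\,\mu_H(E)$), and let $\xi_0\in\mathbb{R}^d$ be such that the dual orbit $\mathcal{O}=\{h^T\xi_0 : h\in H\}$ is open in $\mathbb{R}^d$. (This covers all irreducibly admissible dilation groups $H$ with their open dual orbit $\mathcal{O}$.) Let $|\cdot|$ be the Euclidean norm and $\|\cdot\|$ the associated operator norm, and put $$A(\xi)=\min\left(\frac{\mathrm{dist}(\xi,\mathcal{O}^c)}{1+\sqrt{|\xi|^2-\mathrm{dist}(\xi,\mathcal{O}^c)^2}},\ \frac{1}{1+|\xi|}\right)$$ (so $A=0$ on $\mathcal{O}^c$), $A_H(h)=A(h^T\xi_0)$ for $h\in H$, and, for $\ell\in\mathbb{N}$, $$\Phi_\ell(h)=\int_{\mathbb{R}^d}A(\xi)^\ell A(h^T\xi)^\ell\,d\xi\in[0,\infty].$$ Let $s\ge 0$ and let $w_0:H\to(0,\infty)$ be a weight, i.e. continuous with $w_0(gh)\le w_0(g)w_0(h)$ for all $g,h\in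 H$. One says that $\mathcal{O}$ is strongly $(s,w_0)$-temperately embedded with index $\ell$ if $\Phi_\ell$ is finite everywhere on $H$ and belongs to the Wiener amalgam space $W(C^0,\mathrm{L}^1_m)$ with $m(h)=w_0(h)\,|\det h|^{-1/2}\,(1+\|h\|)^{2(s+d+1)}$; that is, $\Phi_\ell$ is continuous on $H$ and, for compact neighborhoods $U\subset H$ of the identity (equivalently for one, or for every such $U$), $$\int_H \Big(\sup_{y\in U}\Phi_\ell(hy)\Big)\,m(h)\,dh<\infty .$$ **Theorem.** Suppose that there are real exponents $e_1,e_2,e_3,e_4$ and a constant $C$ such that for all $h\in H$ $$w_0(h^{\pm1})\,A_H(h)^{e_1}\le C,\qquad \|h^{\pm1}\|\,A_H(h)^{e_2}\le C,\qquad |\det (h^{\pm1})|\,A_H(h)^{e_3}\le C,\qquad \Delta_H(h^{\pm1})\,A_H(h)^{e_4}\le C .$$ (Such exponents are automatically non-negative.) Then $\mathcal{O}$ is strongly $(s,w_0)$-temperately embedded with index $$\ell=\Big\lfloor e_1+e_2(2s+2d+2)+\tfrac32 e_3+e_4\Big\rfloor+d+1 .$$ -/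

import Mathlib

open MeasureTheory Topology
open scoped ENNReal NNReal Matrix

noncomputable section

namespace DilationGroup

/-! ### Weights, modular function and Wiener amalgam spaces on a group -/

section Group

variable {K : Type*} [Group K] [TopologicalSpace K]

/-- A weight on a topological group: a continuous, strictly positive, submultiplicative function. -/
structure IsWeight (w : K → ℝ) : Prop where
  continuous : Continuous w
  pos : ∀ x, 0 < w x
  submul : ∀ x y, w (x * y) ≤ w x * w y

/-- The modular function `Δ` of a group with left Haar measure `μ`, in the normalisation
`μ (E h) = Δ h * μ E`: the push-forward of `μ` under `x ↦ x * h⁻¹` is `E ↦ μ (E h)`, and this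
left invariant measure is `Δ h • μ`. It does not depend on the choice of `μ`. -/
def modularFunction [IsTopologicalGroup K] [MeasurableSpace K] [BorelSpace K]
    (μ : Measure K) [μ.IsHaarMeasure] (h : K) : ℝ :=
  (Measure.haarScalarFactor (μ.map (· * h⁻¹)) μ : ℝ)

/-- The local maximum function `(M_U F)(x) = sup_{y ∈ U} |F (x y)|`, with values in `[0, ∞]`. -/
def localMax (U : Set K) (F : K → ℝ) (x : K) : ℝ≥0∞ :=
  ⨆ y ∈ U, ‖F (x * y)‖ₑ

/-- Membership of `F` in the Wiener amalgam space `W(C⁰, L¹_m)` over `(K, μ)`: `F` is continuous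
and `M_U F` has finite weighted integral `∫ (M_U F) m dμ`, for compact neighbourhoods `U` of the
identity (as usual, the choice of `U` is immaterial; finiteness is required for all of them).
For continuous `F` the function `M_U F` is lower semicontinuous, hence measurable. -/
def MemWienerAmalgam [MeasurableSpace K] (μ : Measure K) (m : K → ℝ) (F : K → ℝ) : Prop :=
  Continuous F ∧ ∀ U : Set K, IsCompact U → U ∈ 𝓝 (1 : K) →
    ∫⁻ x, localMax U F x * ENNReal.ofReal (m x) ∂μ < ∞

end Group

/-! ### The dual action, the envelope functions and strong temperate embeddedness -/

variable {d : ℕ}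

/-- The operator norm of `h ∈ GL(d, ℝ)` with respect to the Euclidean norm. -/
def opNorm (h : GL (Fin d) ℝ) : ℝ :=
  ‖Matrix.toEuclideanCLM (n := Fin d) (𝕜 := ℝ) (h : Matrix (Fin d) (Fin d) ℝ)‖

/-- `|det h|`. -/
def absDet (h : GL (Fin d) ℝ) : ℝ :=
  |(h : Matrix (Fin d) (Fin d) ℝ).det|

/-- The dual action `(h, ξ) ↦ hᵀ ξ` of `GL(d, ℝ)` on Euclidean space. -/
def dualAct (h : GL (Fin d) ℝ) (ξ : EuclideanSpace ℝ (Fin d)) : EuclideanSpace ℝ (Fin d) :=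
  Matrix.toEuclideanCLM (n := Fin d) (𝕜 := ℝ) (h : Matrix (Fin d) (Fin d) ℝ)ᵀ ξ

/-- The dual orbit `{hᵀ ξ₀ : h ∈ H}`. -/
def dualOrbit (H : Subgroup (GL (Fin d) ℝ)) (ξ₀ : EuclideanSpace ℝ (Fin d)) :
    Set (EuclideanSpace ℝ (Fin d)) :=
  {ξ | ∃ h ∈ H, ξ = dualAct h ξ₀}

/-- The envelope `A(ξ) = min (dist(ξ, Oᶜ) / (1 + √(|ξ|² - dist(ξ, Oᶜ)²))) (1 / (1 + |ξ|))` of a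
set `O`. The same formula is used on the whole space; it gives `A = 0` on `Oᶜ`. -/
def envelope (O : Set (EuclideanSpace ℝ (Fin d))) (ξ : EuclideanSpace ℝ (Fin d)) : ℝ :=
  min (Metric.infDist ξ Oᶜ / (1 + √(‖ξ‖ ^ 2 - Metric.infDist ξ Oᶜ ^ 2))) (1 / (1 + ‖ξ‖))

/-- `Φ_ℓ(h) = ∫ A(ξ)^ℓ A(hᵀ ξ)^ℓ dξ ∈ [0, ∞]`. -/
def Phi (O : Set (EuclideanSpace ℝ (Fin d))) (l : ℕ) (h : GL (Fin d) ℝ) : ℝ≥0∞ :=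
  ∫⁻ ξ : EuclideanSpace ℝ (Fin d),
    ENNReal.ofReal (envelope O ξ ^ l * envelope O (dualAct h ξ) ^ l)

/-- `O` is strongly `(s, w)`-temperately embedded with index `l`, with respect to the group `H`
with left Haar measure `μ`: the function `Φ_l` is finite on `H` and belongs to `W(C⁰, L¹_m)`
for `m(h) = w(h) |det h|^(-1/2) (1 + ‖h‖)^(2(s+d+1))`. -/
def IsStronglyTemperatelyEmbedded (H : Subgroup (GL (Fin d) ℝ)) [MeasurableSpace H]
    (μ : Measure H) (O : Set (EuclideanSpace ℝ (Fin d))) (s : ℝ) (w : H → ℝ) (l : ℕ) : Prop :=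
  (∀ h : H, Phi O l h < ∞) ∧
    MemWienerAmalgam μ
      (fun h : H => w h * absDet (h : GL (Fin d) ℝ) ^ (-(1 / 2) : ℝ) *
        (1 + opNorm (h : GL (Fin d) ℝ)) ^ (2 * (s + d + 1)))
      (fun h : H => (Phi O l h).toReal)

end DilationGroup

end

/-!
Put `B(ξ) = min (dist(ξ, Oᶜ), 1) / (1 + |ξ|)`. The envelope `A` of the orbit `O` lies between `B` and
`2 B` (`le_envelope`, `envelope_le`), and since `O` is invariant, `B` changes at most by a factor
depending on `‖h‖` and `‖h⁻¹‖` under `ξ ↦ hᵀ ξ`. Hence so does `A` (`envelope_dualAct_le`), and the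
local maximum function of `Φ_l` over a compact set is bounded by a multiple of `Φ_l`
(`exists_localMax_Phi_le`). Finiteness and continuity of `Φ_l` follow by dominated convergence from
`A(ξ) ≤ 1 / (1 + |ξ|)` and `l > d`, so it remains to show `∫_H Φ_l m < ∞`.

By Tonelli, `∫_H Φ_l m = ∫ A(ξ)^l G(ξ) dξ` with the orbit integral `G(ξ) = ∫_H A(hᵀ ξ)^l m(h) dh`.
The weight `m` is submultiplicative and the Haar measure is left invariant, so
`G(gᵀ ξ₀) ≤ m(g⁻¹) G(ξ₀)` and `G(ξ₀) ≤ m(g) G(gᵀ ξ₀)`. The first inequality reduces the claim to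
`G(ξ₀) < ∞` and a bound on `A(gᵀ ξ₀)^l m(g⁻¹)`. The second shows that it suffices to find one point
of `O` at which `G` is finite. For this, `G` is integrated over the superlevel set `N = {ε ≤ A}`
(`orbitIntegral_self_lt_top`): after the substitution `η = hᵀ ξ` the inner integral at `η = gᵀ ξ₀`
runs over `K⁻¹ g`, where `K = {k | ε ≤ A(kᵀ ξ₀)}` is compact because `A` controls `‖k‖` and `‖k⁻¹‖`,
and it is at most a constant times `Δ(g) |det g|⁻¹ m(g)`. No uniqueness theorem for invariant
measures on `O`, and no assumption on stabilizers, is needed.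

With `E = e₁ + e₂ (2 s + 2 d + 2) + (3 / 2) e₃ + e₄`, both `Δ(g) |det g|⁻¹ m(g)` and `m(g⁻¹)` are
bounded by multiples of `A(gᵀ ξ₀)^(-E)`. As `l > E + d`, the two outer integrands are dominated by
`(1 + |ξ|)^(-(l - E))`, which is integrable. The signs of the exponents play no role: instead of
`0 ≤ eᵢ`, the argument uses that `A^(eᵢ)` is bounded, which follows from `h h⁻¹ = 1`.
-/

open MeasureTheory Topology
open scoped ENNReal NNReal Matrix

noncomputable section

namespace DilationGroup

variable {d : ℕ}

/-! ### The dual action, the operator norm and the determinant -/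

lemma dualAct_mul (g h : GL (Fin d) ℝ) (ξ : EuclideanSpace ℝ (Fin d)) :
    dualAct (g * h) ξ = dualAct h (dualAct g ξ) := by
  simp only [dualAct, Units.val_mul, Matrix.transpose_mul, map_mul]
  rfl

lemma dualAct_one (ξ : EuclideanSpace ℝ (Fin d)) : dualAct 1 ξ = ξ := by
  simp [dualAct]

lemma dualAct_inv_dualAct (h : GL (Fin d) ℝ) (ξ : EuclideanSpace ℝ (Fin d)) :
    dualAct h⁻¹ (dualAct h ξ) = ξ := by
  rw [← dualAct_mul, mul_inv_cancel, dualAct_one]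

lemma opNorm_nonneg (h : GL (Fin d) ℝ) : 0 ≤ opNorm h := norm_nonneg _

lemma opNorm_mul_le (g h : GL (Fin d) ℝ) : opNorm (g * h) ≤ opNorm g * opNorm h := by
  simp only [opNorm, Units.val_mul, map_mul]
  exact norm_mul_le _ _

lemma norm_toEuclideanCLM_transpose (M : Matrix (Fin d) (Fin d) ℝ) :
    ‖Matrix.toEuclideanCLM (n := Fin d) (𝕜 := ℝ) Mᵀ‖ =
      ‖Matrix.toEuclideanCLM (n := Fin d) (𝕜 := ℝ) M‖ := by
  have h : Mᵀ = star M := by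
    rw [Matrix.star_eq_conjTranspose, Matrix.conjTranspose_eq_transpose_of_trivial]
  rw [h, map_star, ContinuousLinearMap.star_eq_adjoint, LinearIsometryEquiv.norm_map]

lemma norm_dualAct_sub_le (h : GL (Fin d) ℝ) (ξ η : EuclideanSpace ℝ (Fin d)) :
    ‖dualAct h ξ - dualAct h η‖ ≤ opNorm h * ‖ξ - η‖ := by
  rw [dualAct, dualAct, ← map_sub, opNorm, ← norm_toEuclideanCLM_transpose]
  exact ContinuousLinearMap.le_opNorm _ _

lemma norm_dualAct_le (h : GL (Fin d) ℝ) (ξ : EuclideanSpace ℝ (Fin d)) :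
    ‖dualAct h ξ‖ ≤ opNorm h * ‖ξ‖ := by
  rw [dualAct, opNorm, ← norm_toEuclideanCLM_transpose]
  exact ContinuousLinearMap.le_opNorm _ _

lemma one_le_opNorm_mul_opNorm_inv (hd : 1 ≤ d) (h : GL (Fin d) ℝ) :
    1 ≤ opNorm h * opNorm h⁻¹ := by
  have : Nonempty (Fin d) := ⟨⟨0, hd⟩⟩
  refine le_trans ?_ (opNorm_mul_le h h⁻¹)
  simp [opNorm]

lemma absDet_pos (h : GL (Fin d) ℝ) : 0 < absDet h :=
  abs_pos.2 ((Matrix.isUnit_iff_isUnit_det _).1 h.isUnit).ne_zero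

lemma absDet_mul (g h : GL (Fin d) ℝ) : absDet (g * h) = absDet g * absDet h := by
  simp [absDet, abs_mul]

lemma absDet_mul_absDet_inv (h : GL (Fin d) ℝ) : absDet h * absDet h⁻¹ = 1 := by
  rw [← absDet_mul, mul_inv_cancel]
  simp [absDet]

lemma absDet_inv (h : GL (Fin d) ℝ) : absDet h⁻¹ = (absDet h)⁻¹ :=
  eq_inv_of_mul_eq_one_right (absDet_mul_absDet_inv h)

/-- The identification of matrices with operators on Euclidean space, as a linear homeomorphism. -/
def matrixEquivCLM (d : ℕ) : Matrix (Fin d) (Fin d) ℝ ≃L[ℝ]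
    (EuclideanSpace ℝ (Fin d) →L[ℝ] EuclideanSpace ℝ (Fin d)) :=
  (Matrix.toEuclideanCLM (n := Fin d) (𝕜 := ℝ)).toAlgEquiv.toLinearEquiv.toContinuousLinearEquiv

lemma matrixEquivCLM_apply (M : Matrix (Fin d) (Fin d) ℝ) :
    matrixEquivCLM d M = Matrix.toEuclideanCLM (n := Fin d) (𝕜 := ℝ) M := rfl

lemma continuous_opNorm : Continuous (opNorm : GL (Fin d) ℝ → ℝ) :=
  ((matrixEquivCLM d).continuous.comp Units.continuous_val).norm

lemma continuous_absDet : Continuous (absDet : GL (Fin d) ℝ → ℝ) :=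
  (Units.continuous_val.matrix_det).abs

lemma continuous_dualAct :
    Continuous fun p : GL (Fin d) ℝ × EuclideanSpace ℝ (Fin d) => dualAct p.1 p.2 := by
  have h : Continuous fun p : GL (Fin d) ℝ × EuclideanSpace ℝ (Fin d) =>
      matrixEquivCLM d ((p.1 : Matrix (Fin d) (Fin d) ℝ)ᵀ) :=
    (matrixEquivCLM d).continuous.comp (Units.continuous_val.comp continuous_fst).matrix_transpose
  exact h.clm_apply continuous_snd

/-- Change of variables for the dual action. -/
lemma lintegral_comp_dualAct (h : GL (Fin d) ℝ) (f : EuclideanSpace ℝ (Fin d) → ℝ≥0∞)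
    (hf : Measurable f) :
    ∫⁻ ξ, f (dualAct h ξ) = ENNReal.ofReal (absDet h)⁻¹ * ∫⁻ ξ, f ξ := by
  set L := Matrix.toEuclideanCLM (n := Fin d) (𝕜 := ℝ) (h : Matrix (Fin d) (Fin d) ℝ)ᵀ
  have hdet : LinearMap.det (L : EuclideanSpace ℝ (Fin d) →ₗ[ℝ] EuclideanSpace ℝ (Fin d)) =
      (h : Matrix (Fin d) (Fin d) ℝ).det := by
    rw [← Matrix.det_transpose, Matrix.coe_toEuclideanCLM_eq_toEuclideanLin,
      Matrix.toEuclideanLin_eq_toLin_orthonormal, LinearMap.det_toLin]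
  have hne : LinearMap.det (L : EuclideanSpace ℝ (Fin d) →ₗ[ℝ] EuclideanSpace ℝ (Fin d)) ≠ 0 := by
    rw [hdet]
    exact ((Matrix.isUnit_iff_isUnit_det _).1 h.isUnit).ne_zero
  have hmap := Measure.map_linearMap_addHaar_eq_smul_addHaar
    (volume : Measure (EuclideanSpace ℝ (Fin d))) hne
  have hmeas : Measurable (L : EuclideanSpace ℝ (Fin d) →ₗ[ℝ] EuclideanSpace ℝ (Fin d)) :=
    L.continuous.measurable
  calc ∫⁻ ξ, f (dualAct h ξ)
      = ∫⁻ ξ, f ξ ∂(Measure.map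
          (L : EuclideanSpace ℝ (Fin d) →ₗ[ℝ] EuclideanSpace ℝ (Fin d)) volume) :=
        (lintegral_map hf hmeas).symm
    _ = _ := by
        rw [hmap, lintegral_smul_measure, hdet, abs_inv]
        rfl

/-! ### The envelope of a set whose complement contains the origin -/

section Envelope

variable {O : Set (EuclideanSpace ℝ (Fin d))}

lemma infDist_compl_le_norm (h0 : (0 : EuclideanSpace ℝ (Fin d)) ∈ Oᶜ)
    (ξ : EuclideanSpace ℝ (Fin d)) : Metric.infDist ξ Oᶜ ≤ ‖ξ‖ := by
  simpa using Metric.infDist_le_dist_of_mem (x := ξ) h0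

lemma continuous_envelope : Continuous (envelope O) := by
  unfold envelope
  have h : Continuous fun ξ : EuclideanSpace ℝ (Fin d) => Metric.infDist ξ Oᶜ :=
    Metric.continuous_infDist_pt _
  refine Continuous.min (h.div ?_ fun ξ => by positivity)
    (continuous_const.div (by fun_prop) fun ξ => by positivity)
  exact continuous_const.add (((continuous_norm.pow 2).sub (h.pow 2)).sqrt)

lemma envelope_nonneg (ξ : EuclideanSpace ℝ (Fin d)) : 0 ≤ envelope O ξ := by
  have := Metric.infDist_nonneg (x := ξ) (s := Oᶜ)
  exact le_min (by positivity) (by positivity)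

lemma envelope_le_inv (ξ : EuclideanSpace ℝ (Fin d)) : envelope O ξ ≤ (1 + ‖ξ‖)⁻¹ := by
  rw [← one_div]
  exact min_le_right _ _

lemma envelope_le_one (ξ : EuclideanSpace ℝ (Fin d)) : envelope O ξ ≤ 1 :=
  (envelope_le_inv ξ).trans (inv_le_one_of_one_le₀ (by linarith [norm_nonneg ξ]))

lemma envelope_of_notMem {ξ : EuclideanSpace ℝ (Fin d)} (h : ξ ∉ O) : envelope O ξ = 0 := by
  refine le_antisymm ?_ (envelope_nonneg ξ)
  have : Metric.infDist ξ Oᶜ = 0 := Metric.infDist_zero_of_mem h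
  refine (min_le_left _ _).trans ?_
  simp [this]

lemma envelope_pos (hO : IsOpen O) (h0 : (0 : EuclideanSpace ℝ (Fin d)) ∈ Oᶜ)
    {ξ : EuclideanSpace ℝ (Fin d)} (h : ξ ∈ O) : 0 < envelope O ξ := by
  have : 0 < Metric.infDist ξ Oᶜ :=
    (hO.isClosed_compl.notMem_iff_infDist_pos ⟨0, h0⟩).1 (by simpa using h)
  exact lt_min (by positivity) (by positivity)

/-- The simpler function `min (dist(ξ, Oᶜ), 1) / (1 + |ξ|)` minorizes the envelope. -/
lemma le_envelope (ξ : EuclideanSpace ℝ (Fin d)) :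
    min (Metric.infDist ξ Oᶜ) 1 / (1 + ‖ξ‖) ≤ envelope O ξ := by
  have hδ := Metric.infDist_nonneg (x := ξ) (s := Oᶜ)
  have hn := norm_nonneg ξ
  refine le_min ?_ ?_
  · refine div_le_div₀ hδ (min_le_left _ _) (by positivity) ?_
    have : √(‖ξ‖ ^ 2 - Metric.infDist ξ Oᶜ ^ 2) ≤ ‖ξ‖ :=
      Real.sqrt_le_iff.2 ⟨hn, by nlinarith⟩
    linarith
  · gcongr
    exact min_le_right _ _

/-- Up to a factor of two, `min (dist(ξ, Oᶜ), 1) / (1 + |ξ|)` majorizes the envelope. -/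
lemma envelope_le (h0 : (0 : EuclideanSpace ℝ (Fin d)) ∈ Oᶜ) (ξ : EuclideanSpace ℝ (Fin d)) :
    envelope O ξ ≤ 2 * (min (Metric.infDist ξ Oᶜ) 1 / (1 + ‖ξ‖)) := by
  have hδ := Metric.infDist_nonneg (x := ξ) (s := Oᶜ)
  have hle := infDist_compl_le_norm h0 ξ
  have hn := norm_nonneg ξ
  set δ := Metric.infDist ξ Oᶜ
  rcases le_total δ 1 with h1 | h1
  · rw [min_eq_left h1]
    refine (min_le_left _ _).trans ?_
    have hs : ‖ξ‖ - δ ≤ √(‖ξ‖ ^ 2 - δ ^ 2) := Real.le_sqrt_of_sq_le (by nlinarith)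
    rw [← mul_div_assoc, div_le_div_iff₀ (by positivity) (by positivity)]
    have := Real.sqrt_nonneg (‖ξ‖ ^ 2 - δ ^ 2)
    nlinarith
  · rw [min_eq_right h1]
    refine (min_le_right _ _).trans ?_
    have : 0 ≤ 1 / (1 + ‖ξ‖) := by positivity
    linarith

/-- The envelope of an invariant set is quasi-invariant under the dual action. -/
lemma envelope_dualAct_le (h0 : (0 : EuclideanSpace ℝ (Fin d)) ∈ Oᶜ) {h : GL (Fin d) ℝ}
    (hinv : ∀ ξ ∈ Oᶜ, dualAct h ξ ∈ Oᶜ) (ξ : EuclideanSpace ℝ (Fin d)) :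
    envelope O (dualAct h ξ) ≤ 2 * ((1 + opNorm h) * (1 + opNorm h⁻¹)) * envelope O ξ := by
  have hp := opNorm_nonneg h
  have hq := opNorm_nonneg h⁻¹
  have hδ := Metric.infDist_nonneg (x := ξ) (s := Oᶜ)
  have hdist : Metric.infDist (dualAct h ξ) Oᶜ ≤ (1 + opNorm h) * Metric.infDist ξ Oᶜ := by
    have hp' : 0 < 1 + opNorm h := by positivity
    rw [← div_le_iff₀' hp', Metric.le_infDist ⟨0, h0⟩]
    intro η hη
    rw [div_le_iff₀' hp']
    refine (Metric.infDist_le_dist_of_mem (hinv η hη)).trans ?_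
    rw [dist_eq_norm, dist_eq_norm]
    refine (norm_dualAct_sub_le h ξ η).trans ?_
    gcongr
    linarith
  have hmin : min (Metric.infDist (dualAct h ξ) Oᶜ) 1 ≤
      (1 + opNorm h) * min (Metric.infDist ξ Oᶜ) 1 := by
    rw [mul_min_of_nonneg _ _ (by positivity)]
    exact min_le_min hdist (by linarith)
  have hnorm : 1 + ‖ξ‖ ≤ (1 + opNorm h⁻¹) * (1 + ‖dualAct h ξ‖) := by
    have := norm_dualAct_le h⁻¹ (dualAct h ξ)
    rw [dualAct_inv_dualAct] at this
    nlinarith [norm_nonneg (dualAct h ξ)]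
  have hmin0 : 0 ≤ min (Metric.infDist ξ Oᶜ) 1 := le_min hδ zero_le_one
  calc envelope O (dualAct h ξ)
      ≤ 2 * (min (Metric.infDist (dualAct h ξ) Oᶜ) 1 / (1 + ‖dualAct h ξ‖)) := envelope_le h0 _
    _ ≤ 2 * ((1 + opNorm h) * min (Metric.infDist ξ Oᶜ) 1 *
          ((1 + opNorm h⁻¹) / (1 + ‖ξ‖))) := by
        rw [div_eq_mul_inv]
        gcongr
        rw [inv_le_comm₀ (by positivity) (by positivity), inv_div, div_le_iff₀ (by positivity)]
        linarith
    _ = 2 * ((1 + opNorm h) * (1 + opNorm h⁻¹)) *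
          (min (Metric.infDist ξ Oᶜ) 1 / (1 + ‖ξ‖)) := by ring
    _ ≤ _ := by
        gcongr
        exact le_envelope ξ

end Envelope

/-! ### Topology of closed matrix groups -/

section ClosedSubgroup

variable {H : Subgroup (GL (Fin d) ℝ)}

lemma isClosedEmbedding_embedProduct (hH : IsClosed (H : Set (GL (Fin d) ℝ))) :
    IsClosedEmbedding fun h : H => Units.embedProduct (Matrix (Fin d) (Fin d) ℝ) h :=
  Units.isClosedEmbedding_embedProduct.comp hH.isClosedEmbedding_subtypeVal

lemma secondCountableTopology_subgroup : SecondCountableTopology H := by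
  have : SecondCountableTopology (Matrix (Fin d) (Fin d) ℝ) :=
    inferInstanceAs (SecondCountableTopology (Fin d → Fin d → ℝ))
  have : SecondCountableTopology (Matrix (Fin d) (Fin d) ℝ)ᵐᵒᵖ :=
    MulOpposite.opHomeomorph.symm.isEmbedding.secondCountableTopology
  have : SecondCountableTopology (GL (Fin d) ℝ) :=
    Units.isEmbedding_embedProduct.secondCountableTopology
  exact TopologicalSpace.Subtype.secondCountableTopology (H : Set (GL (Fin d) ℝ))

lemma locallyCompactSpace_of_isClosed (hH : IsClosed (H : Set (GL (Fin d) ℝ))) :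
    LocallyCompactSpace H := by
  have : LocallyCompactSpace (Matrix (Fin d) (Fin d) ℝ) :=
    inferInstanceAs (LocallyCompactSpace (Fin d → Fin d → ℝ))
  exact (isClosedEmbedding_embedProduct hH).locallyCompactSpace

lemma isCompact_setOf_opNorm_le (hH : IsClosed (H : Set (GL (Fin d) ℝ))) (R : ℝ) :
    IsCompact {h : H | opNorm (h : GL (Fin d) ℝ) ≤ R ∧ opNorm ((h⁻¹ : H) : GL (Fin d) ℝ) ≤ R} := by
  have : ProperSpace (EuclideanSpace ℝ (Fin d) →L[ℝ] EuclideanSpace ℝ (Fin d)) :=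
    FiniteDimensional.proper ℝ _
  have hS : IsCompact (matrixEquivCLM d ⁻¹' Metric.closedBall 0 R) :=
    (matrixEquivCLM d).toHomeomorph.isClosedEmbedding.isCompact_preimage
      (isCompact_closedBall _ _)
  have hS' : IsCompact (MulOpposite.unop ⁻¹' (matrixEquivCLM d ⁻¹' Metric.closedBall 0 R)) :=
    MulOpposite.opHomeomorph.symm.isClosedEmbedding.isCompact_preimage hS
  convert (isClosedEmbedding_embedProduct hH).isCompact_preimage (hS.prod hS') using 1
  ext h
  simp [opNorm, matrixEquivCLM_apply]

end ClosedSubgroup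

/-! ### The modular function -/

section Modular

variable {K : Type*} [Group K] [TopologicalSpace K] [IsTopologicalGroup K] [MeasurableSpace K]
  [BorelSpace K] (μ : Measure K) [μ.IsHaarMeasure]

lemma modularFunction_nonneg (g : K) : 0 ≤ modularFunction μ g := NNReal.coe_nonneg _

variable [LocallyCompactSpace K]

lemma modularFunction_eq_modularCharacterFun (g : K) :
    modularFunction μ g = Measure.modularCharacterFun g⁻¹ := by
  rw [modularFunction, Measure.modularCharacterFun_eq_haarScalarFactor μ]

lemma modularFunction_mul_modularFunction_inv (g : K) :
    modularFunction μ g * modularFunction μ g⁻¹ = 1 := by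
  rw [modularFunction_eq_modularCharacterFun, modularFunction_eq_modularCharacterFun,
    ← NNReal.coe_mul, ← Measure.modularCharacterFun_map_mul, mul_inv_cancel,
    Measure.modularCharacterFun_map_one, NNReal.coe_one]

lemma measure_preimage_mul_right_inv [SecondCountableTopology K] (g : K) {E : Set K}
    (hE : MeasurableSet E) :
    μ ((· * g⁻¹) ⁻¹' E) = ENNReal.ofReal (modularFunction μ g) * μ E := by
  have h := Measure.isMulLeftInvariant_eq_smul (μ.map (· * g⁻¹)) μ
  rw [← Measure.map_apply (measurable_mul_const g⁻¹) hE, modularFunction, congrArg (· E) h,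
    ENNReal.ofReal_coe_nnreal, Measure.smul_apply]
  rfl

end Modular

/-! ### Open dual orbits -/

section Orbit

variable {H : Subgroup (GL (Fin d) ℝ)} {ξ₀ : EuclideanSpace ℝ (Fin d)}

lemma self_mem_dualOrbit : ξ₀ ∈ dualOrbit H ξ₀ := ⟨1, H.one_mem, (dualAct_one ξ₀).symm⟩

lemma dualAct_mem_dualOrbit {h : GL (Fin d) ℝ} (hh : h ∈ H) {ξ : EuclideanSpace ℝ (Fin d)}
    (hξ : ξ ∈ dualOrbit H ξ₀) : dualAct h ξ ∈ dualOrbit H ξ₀ := by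
  obtain ⟨g, hg, rfl⟩ := hξ
  exact ⟨g * h, H.mul_mem hg hh, (dualAct_mul g h ξ₀).symm⟩

lemma dualAct_mem_compl_dualOrbit {h : GL (Fin d) ℝ} (hh : h ∈ H)
    {ξ : EuclideanSpace ℝ (Fin d)} (hξ : ξ ∈ (dualOrbit H ξ₀)ᶜ) :
    dualAct h ξ ∈ (dualOrbit H ξ₀)ᶜ := fun hmem => hξ <| by
  simpa only [dualAct_inv_dualAct] using dualAct_mem_dualOrbit (H.inv_mem hh) hmem

/-- In positive dimension an open dual orbit does not contain the origin, whose orbit is a point. -/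
lemma zero_mem_compl_dualOrbit (hd : 1 ≤ d) (hopen : IsOpen (dualOrbit H ξ₀)) :
    (0 : EuclideanSpace ℝ (Fin d)) ∈ (dualOrbit H ξ₀)ᶜ := by
  intro h0
  have hzero (g : GL (Fin d) ℝ) : dualAct g (0 : EuclideanSpace ℝ (Fin d)) = 0 := by
    simp [dualAct]
  have hξ₀ : ξ₀ = 0 := by
    obtain ⟨g, -, hg⟩ := h0
    rw [← dualAct_inv_dualAct g ξ₀, ← hg, hzero]
  have horbit : dualOrbit H ξ₀ = {0} := by
    refine Set.Subset.antisymm ?_ (by simpa using h0)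
    rintro _ ⟨g, -, rfl⟩
    rw [hξ₀, hzero]
    rfl
  have : Nonempty (Fin d) := ⟨⟨0, hd⟩⟩
  rw [horbit] at hopen
  exact not_isOpen_singleton (0 : EuclideanSpace ℝ (Fin d)) hopen

end Orbit

/-! ### The orbit integral of the envelope -/

lemma continuous_dualAct_subgroup (H : Subgroup (GL (Fin d) ℝ)) :
    Continuous fun p : H × EuclideanSpace ℝ (Fin d) => dualAct (p.1 : GL (Fin d) ℝ) p.2 :=
  (continuous_dualAct (d := d)).comp
    (f := fun p : H × EuclideanSpace ℝ (Fin d) => ((p.1 : GL (Fin d) ℝ), p.2)) (by fun_prop)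

section OrbitIntegral

variable {H : Subgroup (GL (Fin d) ℝ)} [MeasurableSpace H]

/-- The orbit integral `ξ ↦ ∫_H A(hᵀ ξ)^l m(h) dh` of a power of the envelope `A` of `O`. -/
def orbitIntegral (μ : Measure H) (O : Set (EuclideanSpace ℝ (Fin d))) (l : ℕ) (m : H → ℝ)
    (ξ : EuclideanSpace ℝ (Fin d)) : ℝ≥0∞ :=
  ∫⁻ h : H, ENNReal.ofReal (envelope O (dualAct (h : GL (Fin d) ℝ) ξ) ^ l) *
    ENNReal.ofReal (m h) ∂μ

variable [BorelSpace H] {μ : Measure H} {O : Set (EuclideanSpace ℝ (Fin d))} {l : ℕ} {m : H → ℝ}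

lemma orbitIntegral_dualAct_le [μ.IsMulLeftInvariant] (hm : IsWeight m) (g : H)
    (ξ : EuclideanSpace ℝ (Fin d)) :
    orbitIntegral μ O l m (dualAct (g : GL (Fin d) ℝ) ξ) ≤
      ENNReal.ofReal (m g⁻¹) * orbitIntegral μ O l m ξ := by
  unfold orbitIntegral
  rw [← lintegral_const_mul' _ _ ENNReal.ofReal_ne_top,
    ← lintegral_mul_left_eq_self (fun h : H => ENNReal.ofReal (m g⁻¹) *
      (ENNReal.ofReal (envelope O (dualAct (h : GL (Fin d) ℝ) ξ) ^ l) * ENNReal.ofReal (m h))) g]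
  refine lintegral_mono fun h => ?_
  rw [Subgroup.coe_mul, dualAct_mul, mul_left_comm, ← ENNReal.ofReal_mul (hm.pos _).le]
  gcongr
  simpa using hm.submul g⁻¹ (g * h)

lemma orbitIntegral_le_dualAct [μ.IsMulLeftInvariant] (hm : IsWeight m) (g : H)
    (ξ : EuclideanSpace ℝ (Fin d)) :
    orbitIntegral μ O l m ξ ≤
      ENNReal.ofReal (m g) * orbitIntegral μ O l m (dualAct (g : GL (Fin d) ℝ) ξ) := by
  simpa [dualAct_inv_dualAct] using
    orbitIntegral_dualAct_le (μ := μ) (O := O) (l := l) hm g⁻¹ (dualAct (g : GL (Fin d) ℝ) ξ)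

lemma measurable_ofReal_envelope_pow (O : Set (EuclideanSpace ℝ (Fin d))) (l : ℕ) :
    Measurable fun ξ => ENNReal.ofReal (envelope O ξ ^ l) :=
  (continuous_envelope.pow l).measurable.ennreal_ofReal

lemma measurable_dualAct_subgroup [SecondCountableTopology H] :
    Measurable fun p : H × EuclideanSpace ℝ (Fin d) => dualAct (p.1 : GL (Fin d) ℝ) p.2 :=
  (continuous_dualAct_subgroup H).measurable

/-- Interchanging the integrations and substituting `η = hᵀ ξ` moves the dual action from the
envelope to the set over which an orbit integral is averaged. -/
lemma setLIntegral_orbitIntegral [SecondCountableTopology H] [SFinite μ] (hm : Continuous m)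
    {N : Set (EuclideanSpace ℝ (Fin d))} (hN : MeasurableSet N) :
    ∫⁻ ξ in N, orbitIntegral μ O l m ξ =
      ∫⁻ η, ENNReal.ofReal (envelope O η ^ l) *
        ∫⁻ h : H, N.indicator 1 (dualAct ((h : GL (Fin d) ℝ)⁻¹) η) *
          (ENNReal.ofReal (m h) * ENNReal.ofReal (absDet (h : GL (Fin d) ℝ))⁻¹) ∂μ := by
  have hM : Measurable fun h : H => ENNReal.ofReal (m h) := hm.measurable.ennreal_ofReal
  have hD : Measurable fun h : H => ENNReal.ofReal (absDet (h : GL (Fin d) ℝ))⁻¹ :=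
    (continuous_absDet.comp continuous_subtype_val).measurable.inv.ennreal_ofReal
  have hA := measurable_ofReal_envelope_pow O l
  have hind : Measurable (N.indicator (1 : EuclideanSpace ℝ (Fin d) → ℝ≥0∞)) :=
    measurable_one.indicator hN
  have hact := measurable_dualAct_subgroup (H := H)
  have hactinv : Measurable fun p : H × EuclideanSpace ℝ (Fin d) =>
      dualAct ((p.1 : GL (Fin d) ℝ)⁻¹) p.2 := by
    have := hact.comp ((measurable_fst.inv).prodMk measurable_snd :
      Measurable fun p : H × EuclideanSpace ℝ (Fin d) => (p.1⁻¹, p.2))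
    simpa [Function.comp_def] using this
  calc ∫⁻ ξ in N, orbitIntegral μ O l m ξ
      = ∫⁻ ξ, ∫⁻ h : H, N.indicator 1 ξ *
          (ENNReal.ofReal (envelope O (dualAct (h : GL (Fin d) ℝ) ξ) ^ l) *
            ENNReal.ofReal (m h)) ∂μ := by
        rw [← lintegral_indicator hN]
        refine lintegral_congr fun ξ => ?_
        by_cases hξ : ξ ∈ N <;> simp [hξ, orbitIntegral]
    _ = ∫⁻ h : H, (∫⁻ ξ, N.indicator 1 ξ *
          (ENNReal.ofReal (envelope O (dualAct (h : GL (Fin d) ℝ) ξ) ^ l) *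
            ENNReal.ofReal (m h))) ∂μ := by
        refine lintegral_lintegral_swap (Measurable.aemeasurable ?_)
        exact (hind.comp measurable_fst).mul
          ((hA.comp (hact.comp measurable_swap)).mul (hM.comp measurable_snd))
    _ = ∫⁻ h : H, (∫⁻ η, ENNReal.ofReal (envelope O η ^ l) *
          (N.indicator 1 (dualAct ((h : GL (Fin d) ℝ)⁻¹) η) *
          (ENNReal.ofReal (m h) * ENNReal.ofReal (absDet (h : GL (Fin d) ℝ))⁻¹))) ∂μ := by
        refine lintegral_congr fun h => ?_
        have hmeas : Measurable fun η : EuclideanSpace ℝ (Fin d) =>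
            N.indicator 1 (dualAct ((h : GL (Fin d) ℝ)⁻¹) η) *
              (ENNReal.ofReal (envelope O η ^ l) * ENNReal.ofReal (m h)) :=
          (hind.comp (hactinv.comp measurable_prodMk_left)).mul (hA.mul_const _)
        have := lintegral_comp_dualAct (h : GL (Fin d) ℝ) _ hmeas
        simp only [dualAct_inv_dualAct] at this
        rw [this, ← lintegral_const_mul' _ _ ENNReal.ofReal_ne_top]
        refine lintegral_congr fun η => ?_
        ring
    _ = ∫⁻ η, ∫⁻ h : H, ENNReal.ofReal (envelope O η ^ l) *
          (N.indicator 1 (dualAct ((h : GL (Fin d) ℝ)⁻¹) η) *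
          (ENNReal.ofReal (m h) * ENNReal.ofReal (absDet (h : GL (Fin d) ℝ))⁻¹)) ∂μ := by
        refine lintegral_lintegral_swap (Measurable.aemeasurable ?_)
        exact (hA.comp measurable_snd).mul
          ((hind.comp hactinv).mul ((hM.comp measurable_fst).mul (hD.comp measurable_fst)))
    _ = _ := by
        refine lintegral_congr fun η => ?_
        rw [lintegral_const_mul' _ _ ENNReal.ofReal_ne_top]

/-- Tonelli's theorem expresses the weighted integral of `Φ_l` by orbit integrals. -/
lemma lintegral_Phi_mul [SecondCountableTopology H] [SFinite μ] (hm : Continuous m) :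
    ∫⁻ h : H, Phi O l h * ENNReal.ofReal (m h) ∂μ =
      ∫⁻ ξ, ENNReal.ofReal (envelope O ξ ^ l) * orbitIntegral μ O l m ξ := by
  have hA := measurable_ofReal_envelope_pow O l
  calc ∫⁻ h : H, Phi O l h * ENNReal.ofReal (m h) ∂μ
      = ∫⁻ h : H, (∫⁻ ξ, ENNReal.ofReal (envelope O ξ ^ l) *
          (ENNReal.ofReal (envelope O (dualAct (h : GL (Fin d) ℝ) ξ) ^ l) *
            ENNReal.ofReal (m h))) ∂μ := by
        refine lintegral_congr fun h => ?_
        rw [Phi, ← lintegral_mul_const' _ _ ENNReal.ofReal_ne_top]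
        refine lintegral_congr fun ξ => ?_
        rw [ENNReal.ofReal_mul (pow_nonneg (envelope_nonneg _) _), mul_assoc]
    _ = ∫⁻ ξ, ∫⁻ h : H, ENNReal.ofReal (envelope O ξ ^ l) *
          (ENNReal.ofReal (envelope O (dualAct (h : GL (Fin d) ℝ) ξ) ^ l) *
            ENNReal.ofReal (m h)) ∂μ := by
        refine lintegral_lintegral_swap (Measurable.aemeasurable ?_)
        exact (hA.comp measurable_snd).mul
          ((hA.comp measurable_dualAct_subgroup).mul
            (hm.measurable.ennreal_ofReal.comp measurable_fst))
    _ = _ := by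
        refine lintegral_congr fun ξ => ?_
        rw [lintegral_const_mul' _ _ ENNReal.ofReal_ne_top, orbitIntegral]

end OrbitIntegral

/-! ### Finiteness of the orbit integral -/

section Finiteness

lemma lintegral_const_mul_one_add_norm_rpow_lt_top (C : ℝ) {p : ℝ} (hp : d < p) :
    ∫⁻ ξ : EuclideanSpace ℝ (Fin d), ENNReal.ofReal (C * (1 + ‖ξ‖) ^ (-p)) < ∞ := by
  refine Integrable.lintegral_lt_top (Integrable.const_mul (integrable_one_add_norm ?_) C)
  simpa using hp

lemma IsWeight.mul {K : Type*} [Group K] [TopologicalSpace K] {v w : K → ℝ} (hv : IsWeight v)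
    (hw : IsWeight w) : IsWeight fun x => v x * w x where
  continuous := hv.continuous.mul hw.continuous
  pos x := mul_pos (hv.pos x) (hw.pos x)
  submul x y := by
    rw [mul_mul_mul_comm]
    exact mul_le_mul (hv.submul x y) (hw.submul x y) (hw.pos _).le
      (mul_pos (hv.pos x) (hv.pos y)).le

lemma isWeight_absDet_rpow (H : Subgroup (GL (Fin d) ℝ)) (r : ℝ) :
    IsWeight fun h : H => absDet (h : GL (Fin d) ℝ) ^ r where
  continuous := (continuous_absDet.comp continuous_subtype_val).rpow_const
    fun h => Or.inl (absDet_pos _).ne'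
  pos h := Real.rpow_pos_of_pos (absDet_pos _) _
  submul g h := by
    rw [Subgroup.coe_mul, absDet_mul, Real.mul_rpow (absDet_pos _).le (absDet_pos _).le]

lemma isWeight_one_add_opNorm_rpow (H : Subgroup (GL (Fin d) ℝ)) {r : ℝ} (hr : 0 ≤ r) :
    IsWeight fun h : H => (1 + opNorm (h : GL (Fin d) ℝ)) ^ r where
  continuous := (continuous_const.add (continuous_opNorm.comp continuous_subtype_val)).rpow_const
    fun h => Or.inr hr
  pos h := Real.rpow_pos_of_pos (add_pos_of_pos_of_nonneg one_pos (opNorm_nonneg _)) _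
  submul g h := by
    have hg := opNorm_nonneg (g : GL (Fin d) ℝ)
    have hh := opNorm_nonneg (h : GL (Fin d) ℝ)
    rw [← Real.mul_rpow (by positivity) (by positivity)]
    refine Real.rpow_le_rpow (add_nonneg zero_le_one (opNorm_nonneg _)) ?_ hr
    have := opNorm_mul_le (g : GL (Fin d) ℝ) h
    rw [Subgroup.coe_mul]
    nlinarith

variable {H : Subgroup (GL (Fin d) ℝ)} [MeasurableSpace H] [BorelSpace H] {μ : Measure H}
  [μ.IsHaarMeasure] {ξ₀ : EuclideanSpace ℝ (Fin d)} {l : ℕ} {m : H → ℝ}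

/-- The orbit integral of the base point is finite. Averaging the orbit integral over the
superlevel set `N = {ξ | ε ≤ A(ξ)}` and substituting produces at the point `η = gᵀ ξ₀` an
integral over those `h` with `g h⁻¹` in the compact set `K = {k | ε ≤ A(kᵀ ξ₀)}`, that is, over
`K⁻¹ g`, which has measure `Δ(g) μ(K⁻¹)`. So the average is finite, hence so is the orbit integral
at some point of `N`, and by submultiplicativity of `m` at `ξ₀`. -/
lemma orbitIntegral_self_lt_top [SecondCountableTopology H] [LocallyCompactSpace H]
    (hopen : IsOpen (dualOrbit H ξ₀))
    (h0 : (0 : EuclideanSpace ℝ (Fin d)) ∈ (dualOrbit H ξ₀)ᶜ) (hm : IsWeight m) (hl : l ≠ 0)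
    (hK : ∀ ε > 0, IsCompact {h : H | ε ≤ envelope (dualOrbit H ξ₀) (dualAct h ξ₀)})
    {C p : ℝ} (hp : d < p)
    (hC : ∀ h : H, envelope (dualOrbit H ξ₀) (dualAct h ξ₀) ^ l *
      (modularFunction μ h * (m h * (absDet (h : GL (Fin d) ℝ))⁻¹)) ≤
        C * (1 + ‖dualAct h ξ₀‖) ^ (-p)) :
    orbitIntegral μ (dualOrbit H ξ₀) l m ξ₀ < ∞ := by
  set O := dualOrbit H ξ₀ with hO
  set n : H → ℝ := fun h => m h * (absDet (h : GL (Fin d) ℝ))⁻¹ with hn_def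
  have hn : IsWeight n := by
    simpa only [Real.rpow_neg_one] using hm.mul (isWeight_absDet_rpow H (-1))
  have hA₀ : 0 < envelope O ξ₀ := envelope_pos hopen h0 self_mem_dualOrbit
  set ε := envelope O ξ₀ / 2 with hε_def
  have hε : 0 < ε := half_pos hA₀
  set N : Set (EuclideanSpace ℝ (Fin d)) := {ξ | ε ≤ envelope O ξ} with hN_def
  have hNmeas : MeasurableSet N := (isClosed_le continuous_const continuous_envelope).measurableSet
  have hNpos : volume N ≠ 0 := by
    have hsub : {ξ | ε < envelope O ξ} ⊆ N := fun ξ hξ =>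
      show ε ≤ envelope O ξ from le_of_lt (show ε < envelope O ξ from hξ)
    have hop : IsOpen {ξ | ε < envelope O ξ} := isOpen_lt continuous_const continuous_envelope
    have hpos := hop.measure_pos volume ⟨ξ₀, half_lt_self hA₀⟩
    exact (hpos.trans_le (measure_mono hsub)).ne'
  set K : Set H := {h : H | ε ≤ envelope O (dualAct h ξ₀)} with hK_def
  have hKc : IsCompact K := hK ε hε
  obtain ⟨c, hc⟩ : ∃ c, ∀ k ∈ K, n k⁻¹ ≤ c := by
    obtain ⟨c, hc⟩ := (hKc.image (hn.continuous.comp continuous_inv)).bddAbove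
    exact ⟨c, fun k hk => hc ⟨k, hk, rfl⟩⟩
  have hinner (g : H) :
      ∫⁻ h : H, N.indicator 1 (dualAct ((h : GL (Fin d) ℝ)⁻¹) (dualAct g ξ₀)) *
        (ENNReal.ofReal (m h) * ENNReal.ofReal (absDet (h : GL (Fin d) ℝ))⁻¹) ∂μ ≤
      ENNReal.ofReal (c * n g) * (ENNReal.ofReal (modularFunction μ g) * μ K⁻¹) := by
    have hKinv : MeasurableSet K⁻¹ := hKc.inv.measurableSet
    rw [← measure_preimage_mul_right_inv μ g hKinv, ← lintegral_indicator_const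
      (measurable_mul_const g⁻¹ hKinv)]
    refine lintegral_mono fun h => ?_
    rw [← ENNReal.ofReal_mul (hm.pos h).le]
    by_cases hmem : dualAct ((h : GL (Fin d) ℝ)⁻¹) (dualAct g ξ₀) ∈ N
    · have hk : g * h⁻¹ ∈ K := by
        change ε ≤ envelope O (dualAct ((g * h⁻¹ : H) : GL (Fin d) ℝ) ξ₀)
        rw [Subgroup.coe_mul, dualAct_mul, Subgroup.coe_inv]
        exact hmem
      have hpre : h ∈ (· * g⁻¹) ⁻¹' K⁻¹ := by simpa using hk
      rw [Set.indicator_of_mem hmem, Set.indicator_of_mem hpre, Pi.one_apply, one_mul]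
      refine ENNReal.ofReal_le_ofReal ?_
      calc n h = n ((g * h⁻¹)⁻¹ * g) := by congr 1; group
        _ ≤ n (g * h⁻¹)⁻¹ * n g := hn.submul _ _
        _ ≤ c * n g := mul_le_mul_of_nonneg_right (hc _ hk) (hn.pos g).le
    · rw [Set.indicator_of_notMem hmem, zero_mul]
      exact zero_le
  have hc0 : 0 ≤ c := (hn.pos 1).le.trans <| by
    have h1 : (1 : H) ∈ K := by
      change ε ≤ envelope O (dualAct ((1 : H) : GL (Fin d) ℝ) ξ₀)
      rw [Subgroup.coe_one, dualAct_one]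
      exact (half_lt_self hA₀).le
    simpa using hc 1 h1
  have hfin : ∫⁻ ξ in N, orbitIntegral μ O l m ξ < ∞ := by
    rw [setLIntegral_orbitIntegral hm.continuous hNmeas]
    calc _ ≤ ∫⁻ η : EuclideanSpace ℝ (Fin d),
          ENNReal.ofReal (c * C * (1 + ‖η‖) ^ (-p)) * μ K⁻¹ := by
          refine lintegral_mono fun η => ?_
          by_cases hη : η ∈ O
          · obtain ⟨g, hg, rfl⟩ := hη
            refine (mul_le_mul_right (hinner ⟨g, hg⟩) _).trans ?_
            rw [← mul_assoc, ← mul_assoc, ← ENNReal.ofReal_mul (pow_nonneg (envelope_nonneg _) _),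
              ← ENNReal.ofReal_mul (mul_nonneg (pow_nonneg (envelope_nonneg _) _)
                (mul_nonneg hc0 (hn.pos _).le))]
            refine mul_le_mul_left (ENNReal.ofReal_le_ofReal ?_) _
            have := mul_le_mul_of_nonneg_left (hC ⟨g, hg⟩) hc0
            calc _ = c * (envelope O (dualAct g ξ₀) ^ l *
                  (modularFunction μ ⟨g, hg⟩ * n ⟨g, hg⟩)) := by ring
              _ ≤ _ := this
              _ = _ := by ring
          · simp [envelope_of_notMem hη, hl]
      _ < ∞ := by
          rw [lintegral_mul_const' _ _ hKc.inv.measure_lt_top.ne]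
          exact ENNReal.mul_lt_top (lintegral_const_mul_one_add_norm_rpow_lt_top _ hp)
            hKc.inv.measure_lt_top
  -- `N` has positive measure, so the orbit integral cannot be infinite throughout `N`.
  obtain ⟨ξ, hξN, hξ⟩ : ∃ ξ ∈ N, orbitIntegral μ O l m ξ < ∞ := by
    by_contra! hcon
    refine hfin.ne (top_le_iff.1 ?_)
    calc ∞ = ∫⁻ _ in N, ∞ := by
          rw [setLIntegral_const, ENNReal.top_mul hNpos]
      _ ≤ _ := setLIntegral_mono' hNmeas hcon
  have hξO : ξ ∈ O := by
    by_contra hcon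
    have : ε ≤ envelope O ξ := hξN
    rw [envelope_of_notMem hcon] at this
    exact hε.not_ge this
  obtain ⟨g, hg, rfl⟩ := hξO
  exact (orbitIntegral_le_dualAct hm ⟨g, hg⟩ ξ₀).trans_lt
    (ENNReal.mul_lt_top ENNReal.ofReal_lt_top hξ)

/-- If `A(hᵀ ξ₀)^l m(h⁻¹)` and `A(hᵀ ξ₀)^l Δ(h) |det h|⁻¹ m(h)` are `O((1 + |hᵀ ξ₀|)^(-p))` for
some `p > d`, then `Φ_l` is integrable against `m`. -/
lemma lintegral_Phi_mul_lt_top [SecondCountableTopology H] [LocallyCompactSpace H]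
    (hopen : IsOpen (dualOrbit H ξ₀))
    (h0 : (0 : EuclideanSpace ℝ (Fin d)) ∈ (dualOrbit H ξ₀)ᶜ) (hm : IsWeight m) (hl : l ≠ 0)
    (hK : ∀ ε > 0, IsCompact {h : H | ε ≤ envelope (dualOrbit H ξ₀) (dualAct h ξ₀)})
    {C C' p : ℝ} (hp : d < p)
    (hC : ∀ h : H, envelope (dualOrbit H ξ₀) (dualAct h ξ₀) ^ l *
      (modularFunction μ h * (m h * (absDet (h : GL (Fin d) ℝ))⁻¹)) ≤
        C * (1 + ‖dualAct h ξ₀‖) ^ (-p))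
    (hC' : ∀ h : H, envelope (dualOrbit H ξ₀) (dualAct h ξ₀) ^ l * m h⁻¹ ≤
      C' * (1 + ‖dualAct h ξ₀‖) ^ (-p)) :
    ∫⁻ h : H, Phi (dualOrbit H ξ₀) l h * ENNReal.ofReal (m h) ∂μ < ∞ := by
  have hfin := orbitIntegral_self_lt_top (μ := μ) hopen h0 hm hl hK hp hC
  rw [lintegral_Phi_mul hm.continuous]
  calc _ ≤ ∫⁻ ξ : EuclideanSpace ℝ (Fin d), ENNReal.ofReal (C' * (1 + ‖ξ‖) ^ (-p)) *
        orbitIntegral μ (dualOrbit H ξ₀) l m ξ₀ := by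
        refine lintegral_mono fun ξ => ?_
        by_cases hξ : ξ ∈ dualOrbit H ξ₀
        · obtain ⟨g, hg, rfl⟩ := hξ
          refine (mul_le_mul_right (orbitIntegral_dualAct_le hm ⟨g, hg⟩ ξ₀) _).trans ?_
          rw [← mul_assoc, ← ENNReal.ofReal_mul (pow_nonneg (envelope_nonneg _) _)]
          exact mul_le_mul_left (ENNReal.ofReal_le_ofReal (hC' ⟨g, hg⟩)) _
        · simp [envelope_of_notMem hξ, hl]
    _ < ∞ := by
        rw [lintegral_mul_const' _ _ hfin.ne]
        exact ENNReal.mul_lt_top (lintegral_const_mul_one_add_norm_rpow_lt_top _ hp) hfin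

end Finiteness

/-! ### Continuity and local maximum function of `Φ_l` -/

section Continuity

variable {O : Set (EuclideanSpace ℝ (Fin d))} {l : ℕ}

lemma envelope_pow_mul_le (ξ η : EuclideanSpace ℝ (Fin d)) :
    envelope O ξ ^ l * envelope O η ^ l ≤ (1 + ‖ξ‖) ^ (-(l : ℝ)) := by
  rw [Real.rpow_neg (by positivity), Real.rpow_natCast, ← inv_pow]
  calc envelope O ξ ^ l * envelope O η ^ l ≤ (1 + ‖ξ‖)⁻¹ ^ l * 1 := by
        refine mul_le_mul (pow_le_pow_left₀ (envelope_nonneg _) (envelope_le_inv _) _)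
          (pow_le_one₀ (envelope_nonneg _) (envelope_le_one _))
          (pow_nonneg (envelope_nonneg _) _) (by positivity)
    _ = _ := mul_one _

lemma Phi_lt_top (hl : d < l) (h : GL (Fin d) ℝ) : Phi O l h < ∞ := by
  refine lt_of_le_of_lt (lintegral_mono fun ξ => ENNReal.ofReal_le_ofReal ?_)
    (lintegral_const_mul_one_add_norm_rpow_lt_top (d := d) 1 (p := l) (by exact_mod_cast hl))
  rw [one_mul]
  exact envelope_pow_mul_le _ _

lemma continuous_toReal_Phi (H : Subgroup (GL (Fin d) ℝ)) [SecondCountableTopology H]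
    (hl : d < l) :
    Continuous fun h : H => (Phi O l h).toReal := by
  have hcont := (continuous_envelope (O := O)).comp (continuous_dualAct_subgroup H)
  have hslice (h : H) : Continuous fun ξ : EuclideanSpace ℝ (Fin d) =>
      envelope O ξ ^ l * envelope O (dualAct (h : GL (Fin d) ℝ) ξ) ^ l :=
    (continuous_envelope.pow l).mul ((hcont.comp (Continuous.prodMk_right h)).pow l)
  have heq : (fun h : H => (Phi O l h).toReal) = fun h : H =>
      ∫ ξ, envelope O ξ ^ l * envelope O (dualAct (h : GL (Fin d) ℝ) ξ) ^ l := by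
    funext h
    rw [Phi, integral_eq_lintegral_of_nonneg_ae
      (Filter.Eventually.of_forall fun ξ => mul_nonneg (pow_nonneg (envelope_nonneg _) _)
        (pow_nonneg (envelope_nonneg _) _)) (hslice h).aestronglyMeasurable]
  rw [heq]
  refine continuous_of_dominated (bound := fun ξ => (1 + ‖ξ‖) ^ (-(l : ℝ)))
    (fun h => (hslice h).aestronglyMeasurable) (fun h => Filter.Eventually.of_forall fun ξ => ?_)
    (integrable_one_add_norm (by simpa using hl)) (Filter.Eventually.of_forall fun ξ => ?_)
  · rw [Real.norm_of_nonneg (mul_nonneg (pow_nonneg (envelope_nonneg _) _)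
      (pow_nonneg (envelope_nonneg _) _))]
    exact envelope_pow_mul_le _ _
  · exact continuous_const.mul ((hcont.comp (Continuous.prodMk_left ξ)).pow l)

lemma Phi_mul_le {c : ℝ} (hc : 0 ≤ c) {g : GL (Fin d) ℝ}
    (hg : ∀ ξ, envelope O (dualAct g ξ) ≤ c * envelope O ξ) (h : GL (Fin d) ℝ) :
    Phi O l (h * g) ≤ ENNReal.ofReal (c ^ l) * Phi O l h := by
  rw [Phi, Phi, ← lintegral_const_mul' _ _ ENNReal.ofReal_ne_top]
  refine lintegral_mono fun ξ => ?_
  rw [← ENNReal.ofReal_mul (pow_nonneg hc _)]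
  refine ENNReal.ofReal_le_ofReal ?_
  rw [dualAct_mul, mul_left_comm, ← mul_pow c]
  exact mul_le_mul_of_nonneg_left (pow_le_pow_left₀ (envelope_nonneg _) (hg _) _)
    (pow_nonneg (envelope_nonneg _) _)

/-- Over a compact set `U` the local maximum function of `Φ_l` is controlled by `Φ_l` itself, since
the envelope of the orbit is quasi-invariant. -/
lemma exists_localMax_Phi_le {H : Subgroup (GL (Fin d) ℝ)} {ξ₀ : EuclideanSpace ℝ (Fin d)}
    (h0 : (0 : EuclideanSpace ℝ (Fin d)) ∈ (dualOrbit H ξ₀)ᶜ) {U : Set H} (hU : IsCompact U)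
    (l : ℕ) (hl : d < l) :
    ∃ c : ℝ, ∀ h : H, localMax U (fun h : H => (Phi (dualOrbit H ξ₀) l h).toReal) h ≤
      ENNReal.ofReal c * Phi (dualOrbit H ξ₀) l h := by
  have hcont : Continuous fun y : H =>
      2 * ((1 + opNorm (y : GL (Fin d) ℝ)) * (1 + opNorm (y⁻¹ : GL (Fin d) ℝ))) := by
    have h1 : Continuous fun y : H => opNorm (y : GL (Fin d) ℝ) :=
      continuous_opNorm.comp continuous_subtype_val
    have h2 : Continuous fun y : H => opNorm (y⁻¹ : GL (Fin d) ℝ) :=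
      continuous_opNorm.comp continuous_subtype_val.inv
    fun_prop
  obtain ⟨c, hc⟩ := (hU.image hcont).bddAbove
  refine ⟨(max c 0) ^ l, fun h => iSup₂_le fun y hy => ?_⟩
  rw [Real.enorm_of_nonneg ENNReal.toReal_nonneg, ENNReal.ofReal_toReal (Phi_lt_top hl _).ne]
  refine Phi_mul_le (le_max_right _ _) (fun ξ => ?_) _
  refine (envelope_dualAct_le h0 (fun ξ hξ => dualAct_mem_compl_dualOrbit y.2 hξ) ξ).trans ?_
  exact mul_le_mul_of_nonneg_right ((hc ⟨y, hy, rfl⟩).trans (le_max_left _ _)) (envelope_nonneg _)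

end Continuity

/-! ### Powers of the envelope as bounds -/

/-- The shape in which all hypotheses are used: a quantity `x` bounded by a power of `a`. -/
lemma le_mul_rpow_neg {a x C e : ℝ} (ha : 0 < a) (h : x * a ^ e ≤ C) : x ≤ C * a ^ (-e) := by
  rw [Real.rpow_neg ha.le, ← div_eq_mul_inv, le_div_iff₀ (Real.rpow_pos_of_pos ha e)]
  exact h

lemma one_le_of_one_le_mul {x y B : ℝ} (hx : 0 ≤ x) (hxB : x ≤ B) (hyB : y ≤ B)
    (h : 1 ≤ x * y) : 1 ≤ B := by
  by_contra! hB
  nlinarith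

lemma envelope_rpow_le {O : Set (EuclideanSpace ℝ (Fin d))} (ξ : EuclideanSpace ℝ (Fin d))
    {p : ℝ} (hp : 0 ≤ p) : envelope O ξ ^ p ≤ (1 + ‖ξ‖) ^ (-p) := by
  rw [Real.rpow_neg (by positivity), ← Real.inv_rpow (by positivity)]
  exact Real.rpow_le_rpow (envelope_nonneg _) (envelope_le_inv _) hp

/-- The polynomial control of `h` and `h⁻¹` by the envelope makes the superlevel sets of the
envelope along the orbit map compact; in particular the stabilizer of the base point is compact. -/
lemma isCompact_setOf_le_envelope {H : Subgroup (GL (Fin d) ℝ)}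
    (hH : IsClosed (H : Set (GL (Fin d) ℝ))) {O : Set (EuclideanSpace ℝ (Fin d))}
    {ξ₀ : EuclideanSpace ℝ (Fin d)} {C e : ℝ}
    (h : ∀ h : H, opNorm (h : GL (Fin d) ℝ) * envelope O (dualAct h ξ₀) ^ e ≤ C ∧
      opNorm ((h⁻¹ : H) : GL (Fin d) ℝ) * envelope O (dualAct h ξ₀) ^ e ≤ C)
    {ε : ℝ} (hε : 0 < ε) :
    IsCompact {h : H | ε ≤ envelope O (dualAct h ξ₀)} := by
  have hcont : Continuous fun h : H => envelope O (dualAct (h : GL (Fin d) ℝ) ξ₀) := by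
    have hpair : Continuous fun h : H => (h, ξ₀) := by fun_prop
    have hact := (continuous_dualAct_subgroup H).comp hpair
    exact (continuous_envelope (O := O)).comp hact
  have hr : 0 < min (ε ^ e) 1 := lt_min (Real.rpow_pos_of_pos hε e) one_pos
  refine (isCompact_setOf_opNorm_le hH (C / min (ε ^ e) 1)).of_isClosed_subset
    (isClosed_le continuous_const hcont) ?_
  intro k hk
  have hk : ε ≤ envelope O (dualAct k ξ₀) := hk
  have hle : min (ε ^ e) 1 ≤ envelope O (dualAct k ξ₀) ^ e := by
    rcases le_total 0 e with he | he
    · exact (min_le_left _ _).trans (Real.rpow_le_rpow hε.le hk he)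
    · exact (min_le_right _ _).trans
        (Real.one_le_rpow_of_pos_of_le_one_of_nonpos (hε.trans_le hk) (envelope_le_one _) he)
  have key (x : ℝ) (hx : 0 ≤ x) (hxC : x * envelope O (dualAct k ξ₀) ^ e ≤ C) :
      x ≤ C / min (ε ^ e) 1 := by
    rw [le_div_iff₀ hr]
    exact (mul_le_mul_of_nonneg_left hle hx).trans hxC
  exact ⟨key _ (opNorm_nonneg _) (h k).1, key _ (opNorm_nonneg _) (h k).2⟩

/-- The weight `w(h) |det h|^(-1/2) (1 + ‖h‖)^q` is controlled by a power of `a`. The bound `h1`, which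
absorbs the summand `1`, takes the place of a sign condition on `e₂`. -/
lemma weight_le {w δ n a C₁ C₂ C₃ e₁ e₂ e₃ q : ℝ} (ha : 0 < a) (hw : 0 ≤ w) (hδ : 0 < δ)
    (hn : 0 ≤ n) (hq : 0 ≤ q) (hw' : w ≤ C₁ * a ^ (-e₁)) (hn' : n ≤ C₂ * a ^ (-e₂))
    (h1 : 1 ≤ C₂ * a ^ (-e₂)) (hδ' : δ⁻¹ ≤ C₃ * a ^ (-e₃)) :
    w * δ ^ (-(1 / 2) : ℝ) * (1 + n) ^ q ≤
      C₁ * C₃ ^ (1 / 2 : ℝ) * (2 * C₂) ^ q * a ^ (-(e₁ + e₂ * q + 1 / 2 * e₃)) := by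
  have hpos (e : ℝ) : 0 < a ^ (-e) := Real.rpow_pos_of_pos ha _
  have hC₂ : 0 ≤ C₂ := nonneg_of_mul_nonneg_left (zero_le_one.trans h1) (hpos _)
  have hC₃ : 0 ≤ C₃ := nonneg_of_mul_nonneg_left ((inv_pos.2 hδ).le.trans hδ') (hpos _)
  have hdet : δ ^ (-(1 / 2) : ℝ) ≤ C₃ ^ (1 / 2 : ℝ) * a ^ (-(1 / 2 * e₃)) := by
    rw [Real.rpow_neg hδ.le, ← Real.inv_rpow hδ.le,
      show -(1 / 2 * e₃) = -e₃ * (1 / 2) by ring, Real.rpow_mul ha.le,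
      ← Real.mul_rpow hC₃ (hpos _).le]
    exact Real.rpow_le_rpow (inv_pos.2 hδ).le hδ' (by norm_num)
  have hnorm : (1 + n) ^ q ≤ (2 * C₂) ^ q * a ^ (-(e₂ * q)) := by
    rw [show -(e₂ * q) = -e₂ * q by ring, Real.rpow_mul ha.le,
      ← Real.mul_rpow (by positivity) (hpos _).le]
    exact Real.rpow_le_rpow (by positivity) (by linarith) hq
  calc w * δ ^ (-(1 / 2) : ℝ) * (1 + n) ^ q
      ≤ C₁ * a ^ (-e₁) * (C₃ ^ (1 / 2 : ℝ) * a ^ (-(1 / 2 * e₃))) *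
          ((2 * C₂) ^ q * a ^ (-(e₂ * q))) := by
        have := Real.rpow_nonneg hδ.le (-(1 / 2) : ℝ)
        have hw0 := hw.trans hw'
        gcongr
    _ = C₁ * C₃ ^ (1 / 2 : ℝ) * (2 * C₂) ^ q *
          (a ^ (-e₁) * a ^ (-(1 / 2 * e₃)) * a ^ (-(e₂ * q))) := by ring
    _ = _ := by
        rw [← Real.rpow_add ha, ← Real.rpow_add ha]
        ring_nf

end DilationGroup

end

open DilationGroup in
theorem mainTheorem1 (d : ℕ) (hd : 1 ≤ d)
    (H : Subgroup (GL (Fin d) ℝ)) (hH : IsClosed (H : Set (GL (Fin d) ℝ)))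
    [MeasurableSpace H] [BorelSpace H] (μ : MeasureTheory.Measure H) [μ.IsHaarMeasure]
    (ξ₀ : EuclideanSpace ℝ (Fin d)) (O : Set (EuclideanSpace ℝ (Fin d)))
    (hO : O = DilationGroup.dualOrbit H ξ₀) (hO_open : IsOpen O)
    (w₀ : H → ℝ) (hw₀ : DilationGroup.IsWeight w₀) (s : ℝ) (hs : 0 ≤ s)
    (A_H : H → ℝ) (hA_H : ∀ h : H, A_H h = DilationGroup.envelope O (DilationGroup.dualAct h ξ₀))
    (e₁ e₂ e₃ e₄ : ℝ)
    (h₁ : ∃ C : ℝ, ∀ h : H, w₀ h * A_H h ^ e₁ ≤ C ∧ w₀ h⁻¹ * A_H h ^ e₁ ≤ C)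
    (h₂ : ∃ C : ℝ, ∀ h : H, DilationGroup.opNorm (h : GL (Fin d) ℝ) * A_H h ^ e₂ ≤ C ∧
      DilationGroup.opNorm ((h⁻¹ : H) : GL (Fin d) ℝ) * A_H h ^ e₂ ≤ C)
    (h₃ : ∃ C : ℝ, ∀ h : H, DilationGroup.absDet (h : GL (Fin d) ℝ) * A_H h ^ e₃ ≤ C ∧
      DilationGroup.absDet ((h⁻¹ : H) : GL (Fin d) ℝ) * A_H h ^ e₃ ≤ C)
    (h₄ : ∃ C : ℝ, ∀ h : H, DilationGroup.modularFunction μ h * A_H h ^ e₄ ≤ C ∧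
      DilationGroup.modularFunction μ h⁻¹ * A_H h ^ e₄ ≤ C) :
    DilationGroup.IsStronglyTemperatelyEmbedded H μ O s w₀
      (⌊e₁ + e₂ * (2 * s + 2 * d + 2) + 3 / 2 * e₃ + e₄⌋₊ + d + 1) := by
  obtain rfl : A_H = fun h : H => envelope O (dualAct h ξ₀) := funext hA_H
  subst hO
  have := secondCountableTopology_subgroup (H := H)
  have := locallyCompactSpace_of_isClosed hH
  have h0 := zero_mem_compl_dualOrbit hd hO_open
  obtain ⟨C₁, h₁⟩ := h₁
  obtain ⟨C₂, h₂⟩ := h₂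
  obtain ⟨C₃, h₃⟩ := h₃
  obtain ⟨C₄, h₄⟩ := h₄
  set O := dualOrbit H ξ₀
  set q : ℝ := 2 * (s + d + 1) with hq_def
  have hq : 0 ≤ q := by positivity
  set E : ℝ := e₁ + e₂ * (2 * s + 2 * d + 2) + 3 / 2 * e₃ + e₄ with hE_def
  set l := ⌊E⌋₊ + d + 1 with hl_def
  have hdl : d < l := by omega
  have hp : (d : ℝ) < l - E := by
    have := Nat.lt_floor_add_one E
    rw [hl_def]
    push_cast
    linarith
  set m : H → ℝ := fun h => w₀ h * absDet (h : GL (Fin d) ℝ) ^ (-(1 / 2) : ℝ) *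
    (1 + opNorm (h : GL (Fin d) ℝ)) ^ q with hm_def
  have hm : IsWeight m :=
    (hw₀.mul (isWeight_absDet_rpow H _)).mul (isWeight_one_add_opNorm_rpow H hq)
  set D := C₁ * C₃ ^ (1 / 2 : ℝ) * (2 * C₂) ^ q with hD_def
  set F := e₁ + e₂ * q + 1 / 2 * e₃ with hF_def
  have hA (h : H) : 0 < envelope O (dualAct h ξ₀) :=
    envelope_pos hO_open h0 ⟨h, h.2, rfl⟩
  have hdet₃ (h : H) : absDet (h : GL (Fin d) ℝ) ≤ C₃ * envelope O (dualAct h ξ₀) ^ (-e₃) :=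
    le_mul_rpow_neg (hA h) (h₃ h).1
  have hdet₃' (h : H) :
      (absDet (h : GL (Fin d) ℝ))⁻¹ ≤ C₃ * envelope O (dualAct h ξ₀) ^ (-e₃) := by
    rw [← absDet_inv]
    exact le_mul_rpow_neg (hA h) (h₃ h).2
  have hone₂ (h : H) : 1 ≤ C₂ * envelope O (dualAct h ξ₀) ^ (-e₂) :=
    one_le_of_one_le_mul (opNorm_nonneg _) (le_mul_rpow_neg (hA h) (h₂ h).1)
      (le_mul_rpow_neg (hA h) (h₂ h).2) (one_le_opNorm_mul_opNorm_inv hd _)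
  have hone₃ (h : H) : 1 ≤ C₃ * envelope O (dualAct h ξ₀) ^ (-e₃) :=
    one_le_of_one_le_mul (absDet_pos _).le (le_mul_rpow_neg (hA h) (h₃ h).1)
      (le_mul_rpow_neg (hA h) (h₃ h).2) (absDet_mul_absDet_inv _).ge
  have hmod (h : H) : modularFunction μ h ≤ C₄ * envelope O (dualAct h ξ₀) ^ (-e₄) :=
    le_mul_rpow_neg (hA h) (h₄ h).1
  have hone₄ (h : H) : 1 ≤ C₄ * envelope O (dualAct h ξ₀) ^ (-e₄) :=
    one_le_of_one_le_mul (modularFunction_nonneg μ h) (hmod h)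
      (le_mul_rpow_neg (hA h) (h₄ h).2) (modularFunction_mul_modularFunction_inv μ h).ge
  have hm_le (h : H) : m h ≤ D * envelope O (dualAct h ξ₀) ^ (-F) :=
    weight_le (hA h) (hw₀.pos h).le (absDet_pos _) (opNorm_nonneg _) hq
      (le_mul_rpow_neg (hA h) (h₁ h).1) (le_mul_rpow_neg (hA h) (h₂ h).1) (hone₂ h) (hdet₃' h)
  have hm_inv_le (h : H) : m h⁻¹ ≤ D * envelope O (dualAct h ξ₀) ^ (-F) := by
    refine weight_le (hA h) (hw₀.pos _).le (absDet_pos _) (opNorm_nonneg _) hq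
      (le_mul_rpow_neg (hA h) (h₁ h).2) (le_mul_rpow_neg (hA h) (h₂ h).2) (hone₂ h) ?_
    rw [Subgroup.coe_inv, absDet_inv, inv_inv]
    exact hdet₃ h
  -- Both integrands of the finiteness criterion are at most `A ^ (l - E)`, up to a constant. The one
  -- without `Δ(h)` and `|det h|⁻¹` has `1` in their places, which obeys the same bounds.
  have hbound (h : H) (x y z : ℝ) (hx : x ≤ C₄ * envelope O (dualAct h ξ₀) ^ (-e₄))
      (hy0 : 0 ≤ y) (hy : y ≤ D * envelope O (dualAct h ξ₀) ^ (-F)) (hz0 : 0 ≤ z)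
      (hz : z ≤ C₃ * envelope O (dualAct h ξ₀) ^ (-e₃)) :
      envelope O (dualAct h ξ₀) ^ l * (x * (y * z)) ≤
        C₄ * D * C₃ * (1 + ‖dualAct h ξ₀‖) ^ (-(l - E)) := by
    have ha := hA h
    have hprod : 0 ≤ C₄ * D * C₃ := by
      have hpos (e : ℝ) := Real.rpow_pos_of_pos ha e
      exact mul_nonneg (mul_nonneg
        (nonneg_of_mul_nonneg_left (zero_le_one.trans (hone₄ h)) (hpos _))
        (nonneg_of_mul_nonneg_left (hy0.trans hy) (hpos _)))
        (nonneg_of_mul_nonneg_left (zero_le_one.trans (hone₃ h)) (hpos _))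
    calc envelope O (dualAct h ξ₀) ^ l * (x * (y * z))
        ≤ envelope O (dualAct h ξ₀) ^ l * ((C₄ * envelope O (dualAct h ξ₀) ^ (-e₄)) *
            ((D * envelope O (dualAct h ξ₀) ^ (-F)) *
              (C₃ * envelope O (dualAct h ξ₀) ^ (-e₃)))) := by
          have := zero_le_one.trans (hone₄ h)
          have := hy0.trans hy
          gcongr
      _ = C₄ * D * C₃ * (envelope O (dualAct h ξ₀) ^ (l : ℝ) *
            envelope O (dualAct h ξ₀) ^ (-e₄) * envelope O (dualAct h ξ₀) ^ (-F) *
            envelope O (dualAct h ξ₀) ^ (-e₃)) := by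
          rw [Real.rpow_natCast]
          ring
      _ = C₄ * D * C₃ * envelope O (dualAct h ξ₀) ^ (l - E) := by
          rw [← Real.rpow_add ha, ← Real.rpow_add ha, ← Real.rpow_add ha]
          congr 2
          rw [hE_def, hF_def, hq_def]
          ring
      _ ≤ _ := mul_le_mul_of_nonneg_left
          (envelope_rpow_le _ ((Nat.cast_nonneg d).trans hp.le)) hprod
  have hfin : ∫⁻ h : H, Phi O l h * ENNReal.ofReal (m h) ∂μ < ⊤ := by
    refine lintegral_Phi_mul_lt_top hO_open h0 hm (by omega)
      (fun ε hε => isCompact_setOf_le_envelope hH h₂ hε) hp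
      (C := C₄ * D * C₃) (C' := C₄ * D * C₃) (fun h => ?_) (fun h => ?_)
    · exact hbound h _ _ _ (hmod h) (hm.pos h).le (hm_le h) (inv_pos.2 (absDet_pos _)).le
        (hdet₃' h)
    · simpa using hbound h 1 _ 1 (hone₄ h) (hm.pos _).le (hm_inv_le h) zero_le_one (hone₃ h)
  refine ⟨fun h => Phi_lt_top hdl h, continuous_toReal_Phi H hdl, fun U hU _ => ?_⟩
  obtain ⟨c, hc⟩ := exists_localMax_Phi_le h0 hU l hdl
  calc ∫⁻ h : H, localMax U (fun h : H => (Phi O l h).toReal) h * ENNReal.ofReal (m h) ∂μ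
      ≤ ∫⁻ h : H, ENNReal.ofReal c * (Phi O l h * ENNReal.ofReal (m h)) ∂μ := by
        refine MeasureTheory.lintegral_mono fun h => ?_
        rw [← mul_assoc]
        exact mul_le_mul_left (hc h) _
    _ < ⊤ := by
        rw [MeasureTheory.lintegral_const_mul' _ _ ENNReal.ofReal_ne_top]
        exact ENNReal.mul_lt_top ENNReal.ofReal_lt_top hfin
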